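/- An \emph{$\mathcal M$-category} is a category $\mathcal C$ with a class $\mathcal M_{\mathcal C}$ of monics that contains all isomorphisms, is closed under composition, and is such that the pullback of any $m\in\mathcal M_{\mathcal C}$ along any map exists and lies in $\mathcal M_{\mathcal C}$. An \emph{$\mathcal M$-functor} preserves the distinguished monics and pullbacks of them; a natural transformation between $\mathcal M$-functors is \emph{$\mathcal M$-cartesian} if its naturality squares at distinguished monics are pullbacks. Two $\mathcal M$-categories $\mathcal C,\mathcal D$ are \emph{equivalent} if there are $\mathcal M$-functors $F\colon\mathcal C\to\mathcal D$, $G\colon\mathcal D\to\mathcal C$ and natural isomorphisms $1\cong GF$, $FG\cong 1$ that, together with their inverses, are $\mathcal M$-cartesian. Let $\mathcal C$ be an $\mathcal M$-category, and let presheaves be valued in a category $\mathbf{Set}$ of sets large enough to contain the hom-sets and the set of objects of $\mathcal C$ (for small $\mathcal C$: small sets). (1) $\mathsf{PSh}_{\mathcal M}(\mathcal C)$ is the category of presheaves $\mathcal C^{\mathrm{op}}\to\mathbf{Set}$ in which $\mu\colon P\Rightarrow Q$ is distinguished if for every $\gamma\colon \mathbf y D\Rightarrow Q$ there are $m\colon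 E\to D$ in $\mathcal M_{\mathcal C}$ and a map $\mathbf yE\Rightarrow P$ exhibiting $\mathbf y m$ as a pullback of $\mu$ along $\gamma$. (2) $\mathsf{Par}(\mathcal C)$ is the restriction category with the objects of $\mathcal C$, whose maps $A\to B$ are isomorphism classes of spans $(m,f)=(A\xleftarrow{m}Z\xrightarrow{f}B)$ with $m\in\mathcal M_{\mathcal C}$, composed by pullback, with restriction $\overline{(m,f)}=(m,m)$. (3) A \emph{restriction presheaf} on a restriction category $\mathcal X$ is a presheaf $P\colon\mathcal X^{\mathrm{op}}\to\mathbf{Set}$ with an assignment to each $x\in PA$ of a restriction idempotent $\bar x\colon A\to A$ such that $x\cdot\bar x=x$; $\overline{x\cdot e}=\bar x\circ e$ for each restriction idempotent $e$ on $A$; and $\bar x\circ g=g\circ\overline{x\cdot g}$ for each $g\colon B\to A$. With all natural transformations as maps and restriction $\bar\alpha_A(x)=x\cdot\overline{\alpha_A(x)}$, restriction presheaves form a split restriction category $\mathsf{PSh}_r(\mathcal X)$. (4) For a split restriction category $\mathcal X$, $\mathcal M\mathsf{Total}(\mathcal X)$ is the $\mathcal M$-category of all objects and the total maps ($\bar f=1$)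 of $\mathcal X$, the distinguished monics being the restriction monics, i.e. the maps $m$ for which there is $r$ with $rm=1$ and $mr$ a restriction idempotent. \textbf{Theorem.} For every $\mathcal M$-category $\mathcal C$, the $\mathcal M$-categories $\mathcal M\mathsf{Total}(\mathsf{PSh}_r(\mathsf{Par}(\mathcal C)))$ and $\mathsf{PSh}_{\mathcal M}(\mathcal C)$ are equivalent. -/

import Mathlib

open CategoryTheory Opposite

universe w v u v₁ u₁ v₂ u₂

/-! ### Restriction categories -/

/-- A restriction structure on a category: every map `f : A ⟶ B` is assigned `res f : A ⟶ A`.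
Composition is written in diagrammatic order, `f ≫ g` meaning `g ∘ f`. -/
class RestrictionCategory (X : Type u) [Category.{v} X] where
  /-- The restriction of a map. -/
  res {A B : X} (f : A ⟶ B) : A ⟶ A
  res_comp_self {A B : X} (f : A ⟶ B) : res f ≫ f = f
  res_comm {A B D : X} (f : A ⟶ B) (g : A ⟶ D) : res f ≫ res g = res g ≫ res f
  res_res_comp {A B D : X} (f : A ⟶ B) (g : A ⟶ D) : res (res f ≫ g) = res f ≫ res g
  comp_res {A B D : X} (f : A ⟶ B) (h : B ⟶ D) : f ≫ res h = res (f ≫ h) ≫ f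

namespace RestrictionCategory

section

variable {X : Type u} [Category.{v} X] [RestrictionCategory X]

/-- A restriction idempotent is a map equal to its own restriction. -/
def IsRestrictionIdempotent {A : X} (e : A ⟶ A) : Prop := res e = e

/-- A restriction monic is the monic part `m` of a splitting `m ∘ r = e`, `r ∘ m = 1` of a
restriction idempotent `e`. -/
def IsRestrictionMonic {A B : X} (m : A ⟶ B) : Prop :=
  ∃ r : B ⟶ A, IsRestrictionIdempotent (r ≫ m) ∧ m ≫ r = 𝟙 A

lemma res_of_mono {A B : X} (f : A ⟶ B) [Mono f] : res f = 𝟙 A := by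
  rw [← cancel_mono f, res_comp_self, Category.id_comp]

@[simp] lemma res_id (A : X) : res (𝟙 A) = 𝟙 A := res_of_mono _

@[simp] lemma res_res {A B : X} (f : A ⟶ B) : res (res f) = res f := by
  have h := res_res_comp f (𝟙 A)
  simpa using h

lemma res_idem {A B : X} (f : A ⟶ B) : res f ≫ res f = res f := by
  rw [← res_res_comp, res_comp_self]

lemma res_comp_res {A B D : X} (f : A ⟶ B) (h : B ⟶ D) : res (f ≫ res h) = res (f ≫ h) := by
  rw [comp_res, res_res_comp, res_comm, ← res_res_comp, ← Category.assoc, res_comp_self]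

variable (X) in
/-- The total maps: those with restriction the identity. -/
def total : MorphismProperty X := fun A _ f => res f = 𝟙 A

instance : (total X).IsMultiplicative where
  id_mem A := res_id A
  comp_mem f g hf hg := by
    change res _ = _ at hf hg ⊢
    rw [← res_comp_res, hg, Category.comp_id, hf]

lemma IsRestrictionMonic.mono {A B : X} {m : A ⟶ B} (h : IsRestrictionMonic m) : Mono m := by
  obtain ⟨r, -, hr⟩ := h
  exact ⟨fun a b hab => by simpa [hr] using congrArg (· ≫ r) hab⟩

end

/-- The subcategory of a restriction category with the same objects and the total maps. -/
abbrev Total (X : Type u) [Category.{v} X] [RestrictionCategory X] := WideSubcategory (total X)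

/-- A restriction category is split if all its restriction idempotents split. -/
class IsSplit (X : Type u) [Category.{v} X] [RestrictionCategory X] : Prop where
  exists_splitting {A : X} (e : A ⟶ A) (he : IsRestrictionIdempotent e) :
    ∃ (B : X) (m : B ⟶ A) (r : A ⟶ B), r ≫ m = e ∧ m ≫ r = 𝟙 B

end RestrictionCategory

/-! ### M-categories -/

/-- A category with a stable system of monics: a class of monics that contains the isomorphisms, is
closed under composition, and such that the pullback of a member along any map exists and is a
member. -/
class MCategory (C : Type u) [Category.{v} C] where
  /-- The stable system of monics. -/
  monics : MorphismProperty C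
  mono {A B : C} (m : A ⟶ B) (hm : monics m) : Mono m
  iso_mem {A B : C} (f : A ⟶ B) [IsIso f] : monics f
  comp_mem {A B D : C} (m : A ⟶ B) (n : B ⟶ D) (hm : monics m) (hn : monics n) : monics (m ≫ n)
  exists_pullback {A B D : C} (m : A ⟶ D) (f : B ⟶ D) (hm : monics m) :
    ∃ (P : C) (g : P ⟶ A) (n : P ⟶ B), IsPullback g n m f ∧ monics n

/-- An M-functor preserves the distinguished monics and their pullbacks. -/
structure IsMFunctor {C : Type u₁} [Category.{v₁} C] [MCategory C] {D : Type u₂} [Category.{v₂} D]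
    [MCategory D] (F : C ⥤ D) : Prop where
  map_mem {A B : C} (m : A ⟶ B) (hm : MCategory.monics m) : MCategory.monics (F.map m)
  map_isPullback {P A B D : C} (g : P ⟶ A) (n : P ⟶ B) (m : A ⟶ D) (f : B ⟶ D)
    (hm : MCategory.monics m) (h : IsPullback g n m f) :
    IsPullback (F.map g) (F.map n) (F.map m) (F.map f)

/-- A transformation is M-cartesian if its naturality squares at distinguished monics are
pullbacks. -/
def IsMCartesian {C : Type u₁} [Category.{v₁} C] [MCategory C] {D : Type u₂} [Category.{v₂} D]
    {F G : C ⥤ D} (α : F ⟶ G) : Prop :=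
  ∀ ⦃A B : C⦄ (m : A ⟶ B), MCategory.monics m →
    IsPullback (α.app A) (F.map m) (G.map m) (α.app B)

/-- An equivalence of M-categories, that is, an equivalence in the 2-category of M-categories,
M-functors and M-cartesian transformations. -/
structure MEquivalence (C : Type u₁) [Category.{v₁} C] [MCategory C] (D : Type u₂)
    [Category.{v₂} D] [MCategory D] where
  functor : C ⥤ D
  inverse : D ⥤ C
  unitIso : 𝟭 C ≅ functor ⋙ inverse
  counitIso : inverse ⋙ functor ≅ 𝟭 D
  isMFunctor_functor : IsMFunctor functor
  isMFunctor_inverse : IsMFunctor inverse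
  isMCartesian_unitIso_hom : IsMCartesian unitIso.hom
  isMCartesian_unitIso_inv : IsMCartesian unitIso.inv
  isMCartesian_counitIso_hom : IsMCartesian counitIso.hom
  isMCartesian_counitIso_inv : IsMCartesian counitIso.inv

/-! ### The M-category of total maps of a split restriction category -/

namespace RestrictionCategory

variable (X : Type u) [Category.{v} X] [RestrictionCategory X]

/-- The total maps of a split restriction category form an M-category, whose distinguished monics
are the restriction monics. -/
instance [IsSplit X] : MCategory (Total X) where
  monics := fun _ _ m => IsRestrictionMonic m.hom
  mono m hm := by
    have := hm.mono
    exact ⟨fun a b hab => WideSubcategory.hom_ext _ (by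
      rw [← cancel_mono m.hom]
      exact congrArg (fun t => t.hom) hab)⟩
  iso_mem f _ := by
    refine ⟨(inv f).hom, ?_, ?_⟩
    · have h : (inv f).hom ≫ f.hom = 𝟙 _ := by
        rw [← WideSubcategory.comp_def, IsIso.inv_hom_id, WideSubcategory.id_def]
      rw [h]
      exact res_id _
    · rw [← WideSubcategory.comp_def, IsIso.hom_inv_id, WideSubcategory.id_def]
  comp_mem m n hm hn := by
    obtain ⟨r, hr, hmr⟩ := hm
    obtain ⟨s, hs, hns⟩ := hn
    refine ⟨s ≫ r, ?_, ?_⟩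
    · unfold IsRestrictionIdempotent at hr hs ⊢
      have e1 : (s ≫ r) ≫ (m ≫ n).hom = s ≫ (r ≫ m.hom) ≫ n.hom := by simp
      have e2 : s ≫ (r ≫ m.hom) ≫ n.hom = res (s ≫ r ≫ m.hom) ≫ s ≫ n.hom := by
        rw [← Category.assoc s, ← Category.assoc (res _), ← comp_res, hr]
      rw [e1, e2, res_res_comp, hs]
    · simp only [WideSubcategory.comp_def, Category.assoc]
      rw [← Category.assoc n.hom, hns, Category.id_comp, hmr]
  exists_pullback {A B D} m f hm := by
    obtain ⟨r, hr, hmr⟩ := hm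
    unfold IsRestrictionIdempotent at hr
    obtain ⟨P, n, s, hsn, hns⟩ :=
      IsSplit.exists_splitting (res (f.hom ≫ r)) (res_res _)
    have hn : IsRestrictionMonic n := ⟨s, by rw [hsn]; exact res_res _, hns⟩
    have hnm := hn.mono
    have hmm : Mono m.hom := IsRestrictionMonic.mono ⟨r, hr, hmr⟩
    have hnr : n ≫ res (f.hom ≫ r) = n := by
      rw [← hsn, ← Category.assoc, hns, Category.id_comp]
    have hr' : r ≫ m.hom = res r := by
      rw [← hr, ← res_comp_res, res_of_mono m.hom, Category.comp_id]
    have hft : res f.hom = 𝟙 _ := f.property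
    have hg : n ≫ f.hom ≫ r ≫ m.hom = n ≫ f.hom := by
      rw [hr', comp_res, ← Category.assoc, hnr]
    have htot : res (n ≫ f.hom ≫ r) = 𝟙 P := by
      rw [← res_comp_res, hnr, res_of_mono]
    refine ⟨⟨P⟩, ⟨n ≫ f.hom ≫ r, htot⟩, ⟨n, res_of_mono n⟩, ⟨⟨?_⟩, ⟨?_⟩⟩, hn⟩
    · apply WideSubcategory.hom_ext
      simpa using hg
    · refine Limits.PullbackCone.IsLimit.mk _
        (fun c => ⟨c.snd.hom ≫ s, ?_⟩) (fun c => ?_) (fun c => ?_) (fun c k hk1 hk2 => ?_)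
      all_goals
        have hc : c.fst.hom ≫ m.hom = c.snd.hom ≫ f.hom :=
          congrArg (fun t => t.hom) c.condition
        have hcs : c.snd.hom ≫ f.hom ≫ r = c.fst.hom := by
          rw [← Category.assoc, ← hc, Category.assoc, hmr, Category.comp_id]
        have hk : (c.snd.hom ≫ s) ≫ n = c.snd.hom := by
          rw [Category.assoc, hsn, comp_res, hcs,
            show res c.fst.hom = 𝟙 _ from c.fst.property, Category.id_comp]
      · change res _ = _
        rw [← Category.comp_id (c.snd.hom ≫ s), ← res_of_mono n, res_comp_res, hk]
        exact c.snd.property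
      · apply WideSubcategory.hom_ext
        change (c.snd.hom ≫ s) ≫ n ≫ f.hom ≫ r = c.fst.hom
        rw [← Category.assoc, hk, hcs]
      · exact WideSubcategory.hom_ext _ hk
      · apply WideSubcategory.hom_ext
        rw [← cancel_mono n]
        exact (congrArg (fun t => t.hom) hk2).trans hk.symm

end RestrictionCategory

/-! ### The M-category of presheaves on an M-category -/

/-- The category of presheaves on `C`, with values in `Type (max w v)`. For a small category
`C : Type u` with hom-types in `Type u` and `w = u` these are the presheaves with values in
`Type u`. -/
abbrev PShM (C : Type u) [Category.{v} C] := Cᵒᵖ ⥤ Type (max w v)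

namespace PShM

variable {C : Type u} [Category.{v} C] [MCategory C]

/-- A map of presheaves `μ : P ⟶ Q` is distinguished if for every map `γ : yD ⟶ Q` from a
representable there is a distinguished monic `m : E ⟶ D` of `C` and a pullback square with sides
`ym : yE ⟶ yD` and `μ`. -/
def monics : MorphismProperty (PShM.{w} C) := fun P Q μ =>
  ∀ (D : C) (γ : uliftYoneda.{w}.obj D ⟶ Q),
    ∃ (E : C) (m : E ⟶ D) (δ : uliftYoneda.{w}.obj E ⟶ P),
      MCategory.monics m ∧ IsPullback δ (uliftYoneda.{w}.map m) μ γ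

instance : MCategory (PShM.{w} C) where
  monics := monics
  mono {P Q} μ hμ := by
    have key (D : Cᵒᵖ) : Function.Injective (μ.app D) := by
      induction D using Opposite.rec with | _ D =>
      intro x y hxy
      obtain ⟨E, m, δ, hm, hpb⟩ := hμ D (uliftYonedaEquiv.symm (μ.app _ x))
      have hmono := MCategory.mono m hm
      have hx : uliftYonedaEquiv.{w}.symm x ≫ μ =
          𝟙 _ ≫ uliftYonedaEquiv.{w}.symm (μ.app (op D) x) := by
        apply uliftYonedaEquiv.injective
        simp [uliftYonedaEquiv_comp]
      have hy : uliftYonedaEquiv.{w}.symm y ≫ μ =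
          𝟙 _ ≫ uliftYonedaEquiv.{w}.symm (μ.app (op D) x) := by
        apply uliftYonedaEquiv.injective
        simp [uliftYonedaEquiv_comp, hxy]
      have h1 := hpb.lift_snd _ _ hx
      have h2 := hpb.lift_snd _ _ hy
      have : Mono (uliftYoneda.{w}.map m) := by
        refine ⟨fun a b hab => ?_⟩
        ext Z t
        have := congrArg ULift.down (congrArg (fun k => k.app Z t) hab)
        apply ULift.down_injective
        rw [← cancel_mono m]
        exact this
      have h3 : hpb.lift _ _ hx = hpb.lift _ _ hy := by
        rw [← cancel_mono (uliftYoneda.{w}.map m), h1, h2]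
      have h4 := hpb.lift_fst _ _ hx
      rw [h3, hpb.lift_fst] at h4
      exact (uliftYonedaEquiv.symm.injective h4).symm
    refine ⟨fun a b hab => ?_⟩
    ext Z t
    exact key Z (congrArg (fun k => k.app Z t) hab)
  iso_mem {P Q} μ _ D γ := by
    refine ⟨D, 𝟙 D, γ ≫ inv μ, MCategory.iso_mem _, ?_⟩
    rw [CategoryTheory.Functor.map_id]
    exact IsPullback.of_vert_isIso ⟨by simp⟩
  comp_mem μ ν hμ hν D γ := by
    obtain ⟨E, m, δ, hm, h⟩ := hν D γ
    obtain ⟨E', m', δ', hm', h'⟩ := hμ E δ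
    refine ⟨E', m' ≫ m, δ', MCategory.comp_mem _ _ hm' hm, ?_⟩
    rw [CategoryTheory.Functor.map_comp]
    exact h'.paste_vert h
  exists_pullback {P R Q} μ γ hμ := by
    refine ⟨_, _, _, IsPullback.of_hasPullback μ γ, fun D θ => ?_⟩
    obtain ⟨E, m, δ, hm, h⟩ := hμ D (θ ≫ γ)
    have hp := IsPullback.of_hasPullback μ γ
    have hw : δ ≫ μ = (uliftYoneda.{w}.map m ≫ θ) ≫ γ := by rw [h.w, Category.assoc]
    refine ⟨E, m, hp.lift _ _ hw, hm, IsPullback.of_right ?_ (hp.lift_snd _ _ hw) hp⟩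
    rw [hp.lift_fst]
    exact h

end PShM

/-! ### Partial maps in an M-category -/

section Par

variable {C : Type u} [Category.{v} C] [MCategory C]

/-- A span `A ⟵ dom ⟶ B` whose left leg is a distinguished monic. -/
structure PartialMap (A B : C) where
  dom : C
  mon : dom ⟶ A
  mem : MCategory.monics mon
  map : dom ⟶ B

namespace PartialMap

/-- Two spans are identified if they are isomorphic. -/
instance setoid (A B : C) : Setoid (PartialMap A B) where
  r a b := ∃ φ : a.dom ≅ b.dom, φ.hom ≫ b.mon = a.mon ∧ φ.hom ≫ b.map = a.map
  iseqv :=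
    { refl := fun a => ⟨Iso.refl _, by simp, by simp⟩
      symm := by
        rintro a b ⟨φ, h1, h2⟩
        exact ⟨φ.symm, by simp [← h1], by simp [← h2]⟩
      trans := by
        rintro a b c ⟨φ, h1, h2⟩ ⟨ψ, h3, h4⟩
        exact ⟨φ ≪≫ ψ, by simp [h3, h1], by simp [h4, h2]⟩ }

lemma equiv_iff {A B : C} (a b : PartialMap A B) :
    a ≈ b ↔ ∃ φ : a.dom ≅ b.dom, φ.hom ≫ b.mon = a.mon ∧ φ.hom ≫ b.map = a.map := Iff.rfl

lemma mk_equiv_mk {A B P : C} {m m' : P ⟶ A} (hm : MCategory.monics m) (hm' : MCategory.monics m')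
    {f f' : P ⟶ B} (h : m = m') (h' : f = f') :
    (⟨P, m, hm, f⟩ : PartialMap A B) ≈ ⟨P, m', hm', f'⟩ :=
  ⟨Iso.refl _, by simp [h], by simp [h']⟩

/-- The composite of two spans, given a completion of the cospan in the middle. -/
def glue {A B D : C} (a : PartialMap A B) (b : PartialMap B D) {P : C} (g : P ⟶ b.dom)
    (n : P ⟶ a.dom) (hn : MCategory.monics n) : PartialMap A D where
  dom := P
  mon := n ≫ a.mon
  mem := MCategory.comp_mem _ _ hn a.mem
  map := g ≫ b.map

lemma glue_equiv {A B D : C} {a a' : PartialMap A B} {b b' : PartialMap B D} (ha : a ≈ a')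
    (hb : b ≈ b') {P P' : C} {g : P ⟶ b.dom} {n : P ⟶ a.dom} (hn : MCategory.monics n)
    (h : IsPullback g n b.mon a.map) {g' : P' ⟶ b'.dom} {n' : P' ⟶ a'.dom}
    (hn' : MCategory.monics n') (h' : IsPullback g' n' b'.mon a'.map) :
    glue a b g n hn ≈ glue a' b' g' n' hn' := by
  obtain ⟨φ, h1, h2⟩ := ha
  obtain ⟨ψ, h3, h4⟩ := hb
  have h'' : IsPullback (g ≫ ψ.hom) (n ≫ φ.hom) b'.mon a'.map :=
    IsPullback.of_iso h (Iso.refl _) ψ φ (Iso.refl _) (by simp) (by simp) (by simp [h3])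
      (by simp [h2])
  refine ⟨h''.isoIsPullback _ _ h', ?_, ?_⟩
  · have := h''.isoIsPullback_hom_snd _ _ h'
    exact (Category.assoc _ _ _).symm.trans ((congrArg (· ≫ a'.mon) this).trans
      ((Category.assoc _ _ _).trans (congrArg (n ≫ ·) h1)))
  · have := h''.isoIsPullback_hom_fst _ _ h'
    exact (Category.assoc _ _ _).symm.trans ((congrArg (· ≫ b'.map) this).trans
      ((Category.assoc _ _ _).trans (congrArg (g ≫ ·) h4)))

/-- The composite of two spans, by pullback. -/
noncomputable def comp {A B D : C} (a : PartialMap A B) (b : PartialMap B D) : PartialMap A D :=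
  have h := MCategory.exists_pullback b.mon a.map b.mem
  glue a b h.choose_spec.choose h.choose_spec.choose_spec.choose
    h.choose_spec.choose_spec.choose_spec.2

lemma comp_equiv_glue {A B D : C} (a : PartialMap A B) (b : PartialMap B D) {P : C}
    {g : P ⟶ b.dom} {n : P ⟶ a.dom} (hn : MCategory.monics n)
    (h : IsPullback g n b.mon a.map) : comp a b ≈ glue a b g n hn :=
  have h' := (MCategory.exists_pullback b.mon a.map b.mem).choose_spec.choose_spec.choose_spec
  glue_equiv (Setoid.refl a) (Setoid.refl b) h'.2 h'.1 hn h

lemma comp_congr {A B D : C} {a a' : PartialMap A B} {b b' : PartialMap B D} (ha : a ≈ a')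
    (hb : b ≈ b') : comp a b ≈ comp a' b' :=
  have h := (MCategory.exists_pullback b.mon a.map b.mem).choose_spec.choose_spec.choose_spec
  have h' := (MCategory.exists_pullback b'.mon a'.map b'.mem).choose_spec.choose_spec.choose_spec
  glue_equiv ha hb h.2 h.1 h'.2 h'.1

/-- The identity span. -/
def id (A : C) : PartialMap A A := ⟨A, 𝟙 A, MCategory.iso_mem _, 𝟙 A⟩

/-- The restriction `(m, m)` of a span `(m, f)`. -/
def restr {A B : C} (a : PartialMap A B) : PartialMap A A := ⟨a.dom, a.mon, a.mem, a.mon⟩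

end PartialMap

variable (C) in
/-- The category of partial maps in an M-category `C`. It has the objects of `C`, and its maps are
the isomorphism classes of spans whose left leg is a distinguished monic. -/
@[ext] structure Par where of ::
  base : C

namespace Par

/-- The map of `Par C` represented by a span. -/
def mk {A B : Par C} (a : PartialMap A.base B.base) :
    Quotient (PartialMap.setoid A.base B.base) := Quotient.mk _ a

/-- Composition of isomorphism classes of spans. -/
noncomputable def comp {A B D : Par C} (a : Quotient (PartialMap.setoid A.base B.base))
    (b : Quotient (PartialMap.setoid B.base D.base)) :
    Quotient (PartialMap.setoid A.base D.base) :=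
  Quotient.map₂ PartialMap.comp (fun _ _ ha _ _ hb => PartialMap.comp_congr ha hb) a b

lemma comp_mk {A B D : Par C} (a : PartialMap A.base B.base) (b : PartialMap B.base D.base) {P : C}
    {g : P ⟶ b.dom} {n : P ⟶ a.dom} (hn : MCategory.monics n) (h : IsPullback g n b.mon a.map) :
    comp (mk a) (mk b) = mk (PartialMap.glue a b g n hn) :=
  Quotient.sound (PartialMap.comp_equiv_glue a b hn h)

noncomputable instance : Category.{max u v} (Par C) where
  Hom A B := Quotient (PartialMap.setoid A.base B.base)
  id A := mk (PartialMap.id A.base)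
  comp := comp
  id_comp {A B} f := by
    induction f using Quotient.inductionOn with | _ a =>
    refine (comp_mk (A := A) (B := A) (D := B) (PartialMap.id A.base) a (g := 𝟙 a.dom)
      (n := a.mon) a.mem (IsPullback.id_horiz a.mon)).trans ?_
    exact Quotient.sound (PartialMap.mk_equiv_mk _ _ (Category.comp_id _) (Category.id_comp _))
  comp_id {A B} f := by
    induction f using Quotient.inductionOn with | _ a =>
    refine (comp_mk (A := A) (B := B) (D := B) a (PartialMap.id B.base) (g := a.map)
      (n := 𝟙 a.dom) (MCategory.iso_mem _) (IsPullback.id_vert a.map)).trans ?_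
    exact Quotient.sound (PartialMap.mk_equiv_mk _ _ (Category.id_comp _) (Category.comp_id _))
  assoc {A B D E} f g h := by
    induction f using Quotient.inductionOn with | _ a =>
    induction g using Quotient.inductionOn with | _ b =>
    induction h using Quotient.inductionOn with | _ c =>
    obtain ⟨P, p, n, hP, hn⟩ := MCategory.exists_pullback b.mon a.map b.mem
    obtain ⟨Q, q, k, hQ, hk⟩ := MCategory.exists_pullback c.mon b.map c.mem
    obtain ⟨R, s, l, hR, hl⟩ := MCategory.exists_pullback k p hk
    have e1 := comp_mk (A := A) (B := B) (D := D) a b hn hP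
    have e2 := comp_mk (A := B) (B := D) (D := E) b c hk hQ
    have e3 := comp_mk (A := A) (B := D) (D := E) (PartialMap.glue a b p n hn) c hl
      (hR.paste_horiz hQ)
    have e4 := comp_mk (A := A) (B := B) (D := E) a (PartialMap.glue b c q k hk)
      (n := l ≫ n) (g := s) (MCategory.comp_mem _ _ hl hn) (hR.paste_vert hP)
    change comp (comp (mk a) (mk b)) (mk c) = comp (mk a) (comp (mk b) (mk c))
    rw [e1, e2, e3, e4]
    exact Quotient.sound (PartialMap.mk_equiv_mk _ _ (Category.assoc _ _ _).symm
      (Category.assoc _ _ _))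

/-- The map of `Par C` represented by a span. -/
def homMk {A B : Par C} (a : PartialMap A.base B.base) : A ⟶ B := mk a

lemma homMk_surjective {A B : Par C} (f : A ⟶ B) : ∃ a, homMk a = f := Quotient.exists_rep f

lemma homMk_eq_iff {A B : Par C} (a b : PartialMap A.base B.base) :
    (homMk a : A ⟶ B) = homMk b ↔ a ≈ b := Quotient.eq

lemma id_def (A : Par C) : 𝟙 A = homMk (PartialMap.id A.base) := rfl

lemma homMk_comp {A B D : Par C} (a : PartialMap A.base B.base) (b : PartialMap B.base D.base)
    {P : C} {g : P ⟶ b.dom} {n : P ⟶ a.dom} (hn : MCategory.monics n)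
    (h : IsPullback g n b.mon a.map) :
    (homMk a : A ⟶ B) ≫ (homMk b : B ⟶ D) = homMk (PartialMap.glue a b g n hn) :=
  comp_mk a b hn h

/-- The restriction of a partial map `(m, f)` is `(m, m)`. -/
def restr {A B : Par C} (f : A ⟶ B) : A ⟶ A :=
  Quotient.map (sb := PartialMap.setoid A.base A.base) PartialMap.restr
    (by rintro a b ⟨φ, h1, h2⟩; exact ⟨φ, h1, h1⟩) f

lemma restr_homMk {A B : Par C} (a : PartialMap A.base B.base) :
    restr (homMk a : A ⟶ B) = homMk a.restr := rfl

noncomputable instance : RestrictionCategory (Par C) where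
  res := restr
  res_comp_self f := by
    obtain ⟨a, rfl⟩ := homMk_surjective f
    have := MCategory.mono _ a.mem
    rw [restr_homMk, homMk_comp a.restr a (g := 𝟙 a.dom) (n := 𝟙 a.dom) (MCategory.iso_mem (𝟙 a.dom))
      (IsKernelPair.id_of_mono a.mon), homMk_eq_iff]
    exact PartialMap.mk_equiv_mk _ _ (Category.id_comp _) (Category.id_comp _)
  res_comm f g := by
    obtain ⟨a, rfl⟩ := homMk_surjective f
    obtain ⟨b, rfl⟩ := homMk_surjective g
    obtain ⟨P, p, n, hP, hn⟩ := MCategory.exists_pullback b.mon a.mon b.mem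
    obtain ⟨Q, q, k, hQ, hk⟩ := MCategory.exists_pullback a.mon b.mon a.mem
    rw [restr_homMk, restr_homMk, homMk_comp a.restr b.restr hn hP,
      homMk_comp b.restr a.restr hk hQ, homMk_eq_iff]
    have h1 := hP.flip.isoIsPullback_hom_fst _ _ hQ
    have h2 := hP.flip.isoIsPullback_hom_snd _ _ hQ
    refine ⟨hP.flip.isoIsPullback _ _ hQ, ?_, ?_⟩
    · exact (Category.assoc _ _ _).symm.trans ((congrArg (· ≫ b.mon) h2).trans hP.w)
    · exact (Category.assoc _ _ _).symm.trans ((congrArg (· ≫ a.mon) h1).trans hP.w.symm)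
  res_res_comp f g := by
    obtain ⟨a, rfl⟩ := homMk_surjective f
    obtain ⟨b, rfl⟩ := homMk_surjective g
    obtain ⟨P, p, n, hP, hn⟩ := MCategory.exists_pullback b.mon a.mon b.mem
    rw [restr_homMk, restr_homMk, homMk_comp a.restr b hn hP, restr_homMk,
      homMk_comp a.restr b.restr hn hP, homMk_eq_iff]
    exact PartialMap.mk_equiv_mk _ _ rfl hP.w.symm
  comp_res f h := by
    obtain ⟨a, rfl⟩ := homMk_surjective f
    obtain ⟨b, rfl⟩ := homMk_surjective h
    obtain ⟨P, p, n, hP, hn⟩ := MCategory.exists_pullback b.mon a.map b.mem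
    have hm := MCategory.mono _ a.mem
    rw [restr_homMk, homMk_comp a b.restr hn hP, homMk_comp a b hn hP, restr_homMk,
      homMk_comp (PartialMap.glue a b p n hn).restr a (g := n) (n := 𝟙 P) (MCategory.iso_mem (𝟙 P))
        ?_, homMk_eq_iff]
    · exact PartialMap.mk_equiv_mk _ _ (Category.id_comp _).symm hP.w
    · change IsPullback n (𝟙 P) a.mon (n ≫ a.mon)
      refine ⟨⟨by simp⟩, ⟨Limits.PullbackCone.IsLimit.mk _ (fun c => c.snd) (fun c => ?_)
        (fun c => by simp) (fun c k _ hk => by simpa using hk)⟩⟩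
      rw [← cancel_mono a.mon]
      simpa using c.condition.symm

end Par

end Par

/-! ### Restriction presheaves -/

open RestrictionCategory in
/-- A restriction presheaf: a presheaf `P` together with, for each `x ∈ P A`, a restriction
idempotent `res x` on `A`. Here `P.map g.op x` is `x · g`. -/
structure RestrictionPresheaf (X : Type u) [Category.{v} X] [RestrictionCategory X] where
  /-- The underlying presheaf. -/
  toFunctor : Xᵒᵖ ⥤ Type w
  /-- The restriction of an element. -/
  res {A : X} (x : toFunctor.obj (op A)) : A ⟶ A
  isRestrictionIdempotent_res {A : X} (x : toFunctor.obj (op A)) :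
    IsRestrictionIdempotent (res x)
  map_res_self {A : X} (x : toFunctor.obj (op A)) : toFunctor.map (res x).op x = x
  res_map_idempotent {A : X} (x : toFunctor.obj (op A)) (e : A ⟶ A)
    (he : IsRestrictionIdempotent e) : res (toFunctor.map e.op x) = e ≫ res x
  comp_res {A B : X} (x : toFunctor.obj (op A)) (g : B ⟶ A) :
    g ≫ res x = res (toFunctor.map g.op x) ≫ g

namespace RestrictionPresheaf

variable {X : Type u} [Category.{v} X] [RestrictionCategory X]

/-- Maps of restriction presheaves are arbitrary natural transformations. -/
@[ext] structure Hom (P Q : RestrictionPresheaf.{w} X) where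
  nat : P.toFunctor ⟶ Q.toFunctor

@[simps id_nat comp_nat] instance : Category (RestrictionPresheaf.{w} X) where
  Hom P Q := Hom P Q
  id P := ⟨𝟙 _⟩
  comp α β := ⟨α.nat ≫ β.nat⟩

@[ext] lemma hom_ext {P Q : RestrictionPresheaf.{w} X} {α β : P ⟶ Q}
    (h : ∀ (A : X) (x : P.toFunctor.obj (op A)), α.nat.app (op A) x = β.nat.app (op A) x) :
    α = β := by
  apply Hom.ext
  ext ⟨A⟩ x
  exact h A x

lemma map_map (P : RestrictionPresheaf.{w} X) {A B D : X} (x : P.toFunctor.obj (op A)) (f : B ⟶ A)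
    (g : D ⟶ B) : P.toFunctor.map g.op (P.toFunctor.map f.op x) = P.toFunctor.map (g ≫ f).op x := by
  simp

lemma nat_map {P Q : RestrictionPresheaf.{w} X} (α : P ⟶ Q) {A B : X}
    (x : P.toFunctor.obj (op A)) (g : B ⟶ A) :
    α.nat.app (op B) (P.toFunctor.map g.op x) = Q.toFunctor.map g.op (α.nat.app (op A) x) :=
  NatTrans.naturality_apply α.nat g.op x

/-- The restriction of a transformation `α` sends `x` to `x · res (α x)`. -/
def restr {P Q : RestrictionPresheaf.{w} X} (α : P ⟶ Q) : P ⟶ P where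
  nat :=
    { app := fun A => TypeCat.ofHom fun x =>
        P.toFunctor.map (Q.res (A := A.unop) (α.nat.app A x)).op x
      naturality := by
        rintro ⟨A⟩ ⟨B⟩ g
        obtain ⟨g, rfl⟩ : ∃ k : B ⟶ A, g = k.op := ⟨g.unop, rfl⟩
        ext x
        change P.toFunctor.map (Q.res (α.nat.app (op B) (P.toFunctor.map g.op x))).op
          (P.toFunctor.map g.op x) = P.toFunctor.map g.op
            (P.toFunctor.map (Q.res (α.nat.app (op A) x)).op x)
        rw [map_map, map_map, nat_map, ← comp_res] }

lemma restr_apply {P Q : RestrictionPresheaf.{w} X} (α : P ⟶ Q) {A : X}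
    (x : P.toFunctor.obj (op A)) :
    (restr α).nat.app (op A) x = P.toFunctor.map (Q.res (α.nat.app (op A) x)).op x := rfl

lemma res_comm (P Q : RestrictionPresheaf.{w} X) {A : X} (x : P.toFunctor.obj (op A))
    (y : Q.toFunctor.obj (op A)) : P.res x ≫ Q.res y = Q.res y ≫ P.res x := by
  have h1 := P.isRestrictionIdempotent_res x
  have h2 := Q.isRestrictionIdempotent_res y
  unfold RestrictionCategory.IsRestrictionIdempotent at h1 h2
  rw [← h1, ← h2, RestrictionCategory.res_comm]

lemma res_idem (P : RestrictionPresheaf.{w} X) {A : X} (x : P.toFunctor.obj (op A)) :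
    P.res x ≫ P.res x = P.res x := by
  have h1 := P.isRestrictionIdempotent_res x
  unfold RestrictionCategory.IsRestrictionIdempotent at h1
  rw [← h1, RestrictionCategory.res_idem]

instance : RestrictionCategory (RestrictionPresheaf.{w} X) where
  res := restr
  res_comp_self {P Q} α := by
    ext A x
    change α.nat.app (op A) ((restr α).nat.app (op A) x) = _
    rw [restr_apply, nat_map, map_res_self]
  res_comm {P Q R} α β := by
    ext A x
    change (restr β).nat.app (op A) ((restr α).nat.app (op A) x) =
      (restr α).nat.app (op A) ((restr β).nat.app (op A) x)
    simp only [restr_apply, nat_map]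
    rw [map_map, map_map, res_comm Q R]
  res_res_comp {P Q R} α β := by
    ext A x
    change P.toFunctor.map (R.res (β.nat.app (op A) ((restr α).nat.app (op A) x))).op x =
      (restr β).nat.app (op A) ((restr α).nat.app (op A) x)
    simp only [restr_apply, nat_map]
    rw [res_map_idempotent _ _ _ (isRestrictionIdempotent_res _ _), map_map, res_comm Q R]
  comp_res {P Q R} α β := by
    ext A x
    change (restr β).nat.app (op A) (α.nat.app (op A) x) =
      α.nat.app (op A) ((restr (α ≫ β)).nat.app (op A) x)
    simp only [restr_apply, nat_map]
    rfl

/-- The restriction presheaf of elements fixed by an endomorphism. -/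
def fixed {P : RestrictionPresheaf.{w} X} (α : P ⟶ P) : RestrictionPresheaf.{w} X where
  toFunctor :=
    { obj := fun A => { x : P.toFunctor.obj A // α.nat.app A x = x }
      map := fun {A B} g => TypeCat.ofHom fun x => ⟨P.toFunctor.map g x.1, by
        rw [NatTrans.naturality_apply, x.2]⟩
      map_id := fun A => by
        ext x
        exact congrArg (fun k => k x.1) (P.toFunctor.map_id A)
      map_comp := fun f g => by
        ext x
        exact congrArg (fun k => k x.1) (P.toFunctor.map_comp f g) }
  res x := P.res x.1
  isRestrictionIdempotent_res x := P.isRestrictionIdempotent_res x.1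
  map_res_self x := Subtype.ext (P.map_res_self x.1)
  res_map_idempotent x e he := P.res_map_idempotent x.1 e he
  comp_res x g := P.comp_res x.1 g

instance : RestrictionCategory.IsSplit (RestrictionPresheaf.{w} X) where
  exists_splitting {P} α hα := by
    have h2 : α ≫ α = α := by
      unfold RestrictionCategory.IsRestrictionIdempotent at hα
      rw [← hα, RestrictionCategory.res_idem]
    have h3 (A : Xᵒᵖ) (x : P.toFunctor.obj A) :
        α.nat.app A (α.nat.app A x) = α.nat.app A x :=
      congrArg (fun k : P ⟶ P => k.nat.app A x) h2
    refine ⟨fixed α, ⟨{ app := fun A => TypeCat.ofHom fun x => x.1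
                        naturality := fun _ _ _ => rfl }⟩,
      ⟨{ app := fun A => TypeCat.ofHom fun x => ⟨α.nat.app A x, h3 A x⟩
         naturality := fun A B g => ?_ }⟩, ?_, ?_⟩
    · ext x
      have hn := NatTrans.naturality_apply α.nat g x
      exact (Subtype.ext hn :
        (⟨α.nat.app B (P.toFunctor.map g x), h3 B _⟩ : { y // α.nat.app B y = y }) =
          ⟨P.toFunctor.map g (α.nat.app A x), hn ▸ h3 B _⟩)
    · rfl
    · ext A x
      exact Subtype.ext x.2

end RestrictionPresheaf

/-! The equivalence sends a restriction presheaf `P` on `Par C` to its presheaf of total elements,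
those `x` with `res x = 𝟙`, on which the maps of `C` act through `f ↦ (1, f)`. Nothing is lost. A
restriction idempotent of `Par C` has the form `(m, m)`, so every `x` equals `t · (m, 1)` with `t =
x · (1, m)` total (`exists_eq_map_coincl`), and the pair `(m, t)` is unique up to isomorphism
(`map_incl_eq_of_map_coincl_eq`). A transformation of total elements therefore has exactly one
extension to all elements, and this extension is total: the functor is full and faithful. It is
essentially surjective because a presheaf `Q` is recovered as the total part of its partial
elements, the classes of pairs `(m, q)` with `q` in `Q` at the domain of `m`.

It remains to match the distinguished monics. For a restriction monic `μ` with retraction `r`, the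
domain of `r y` represents the pullback of `μ` along a total `y` (`monics_totalElementsMap`).
Conversely, if these pullbacks are representable by distinguished monics, each `y` has a largest
restriction in the image of `μ`, and sending `y` to its preimage defines `r`
(`exists_maximal_preimage`, `isRestrictionMonic_of_monics`). The remaining conditions are automatic:
equivalences preserve pullbacks, and naturality squares of isomorphisms are pullbacks. -/

/-! ### Factorisation of partial maps -/

namespace Par

variable {C : Type u} [Category.{v} C] [MCategory C]

open RestrictionCategory

/-- A map `f` of `C` as the partial map `(1, f)`. -/
def incl {A B : C} (f : A ⟶ B) : Par.of A ⟶ Par.of B :=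
  homMk ⟨A, 𝟙 A, MCategory.iso_mem _, f⟩

/-- A distinguished monic `m` reversed, as the partial map `(m, 1)`. -/
def coincl {Z A : C} (m : Z ⟶ A) (hm : MCategory.monics m) : Par.of A ⟶ Par.of Z :=
  homMk ⟨Z, m, hm, 𝟙 Z⟩

lemma coincl_comp_incl {Z A B : C} (m : Z ⟶ A) (hm : MCategory.monics m) (f : Z ⟶ B) :
    coincl m hm ≫ incl f = homMk ⟨Z, m, hm, f⟩ := by
  unfold coincl incl
  rw [homMk_comp (A := Par.of A) (B := Par.of Z) (D := Par.of B) _ _ (g := 𝟙 Z) (n := 𝟙 Z)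
    (MCategory.iso_mem _) (IsPullback.id_horiz (𝟙 Z)), homMk_eq_iff]
  exact PartialMap.mk_equiv_mk _ _ (Category.id_comp _) (Category.id_comp _)

lemma exists_eq_coincl_comp_incl {A B : C} (f : Par.of A ⟶ Par.of B) :
    ∃ (Z : C) (m : Z ⟶ A) (hm : MCategory.monics m) (g : Z ⟶ B), f = coincl m hm ≫ incl g := by
  obtain ⟨⟨Z, m, hm, g⟩, rfl⟩ := homMk_surjective f
  exact ⟨Z, m, hm, g, (coincl_comp_incl m hm g).symm⟩

lemma coincl_comp_incl_eq_iff {Z Z' A B : C} (m : Z ⟶ A) (hm : MCategory.monics m) (f : Z ⟶ B)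
    (m' : Z' ⟶ A) (hm' : MCategory.monics m') (f' : Z' ⟶ B) :
    coincl m hm ≫ incl f = coincl m' hm' ≫ incl f' ↔
      ∃ φ : Z ≅ Z', φ.hom ≫ m' = m ∧ φ.hom ≫ f' = f := by
  rw [coincl_comp_incl, coincl_comp_incl, homMk_eq_iff]
  rfl

@[simp] lemma incl_id (A : C) : incl (𝟙 A) = 𝟙 (Par.of A) := rfl

@[simp] lemma coincl_id (A : C) (h : MCategory.monics (𝟙 A)) : coincl (𝟙 A) h = 𝟙 (Par.of A) := rfl

/-- This exchange rule brings any composite back to the normal form `(n, 1)` followed by `(1, g)`.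
-/
lemma incl_comp_coincl {P Z A B : C} {g : P ⟶ Z} {n : P ⟶ B} {m : Z ⟶ A} {f : B ⟶ A}
    (hm : MCategory.monics m) (hn : MCategory.monics n) (h : IsPullback g n m f) :
    incl f ≫ coincl m hm = coincl n hn ≫ incl g := by
  rw [coincl_comp_incl]
  unfold coincl incl
  rw [homMk_comp (A := Par.of B) (B := Par.of A) (D := Par.of Z) _ _ hn h, homMk_eq_iff]
  exact PartialMap.mk_equiv_mk _ _ (Category.comp_id _) (Category.comp_id _)

lemma incl_comp {A B D : C} (f : A ⟶ B) (g : B ⟶ D) : incl (f ≫ g) = incl f ≫ incl g := by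
  unfold incl
  rw [homMk_comp (A := Par.of A) (B := Par.of B) (D := Par.of D) _ _ (g := f) (n := 𝟙 A)
    (MCategory.iso_mem _) (IsPullback.id_vert f), homMk_eq_iff]
  exact PartialMap.mk_equiv_mk _ _ (Category.id_comp _).symm rfl

lemma coincl_comp {A B D : C} (m : A ⟶ B) (hm : MCategory.monics m) (n : B ⟶ D)
    (hn : MCategory.monics n) :
    coincl (m ≫ n) (MCategory.comp_mem _ _ hm hn) = coincl n hn ≫ coincl m hm := by
  unfold coincl
  rw [homMk_comp (A := Par.of D) (B := Par.of B) (D := Par.of A) _ _ (g := 𝟙 A) (n := m)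
    hm (IsPullback.id_horiz m), homMk_eq_iff]
  exact PartialMap.mk_equiv_mk _ _ rfl (Category.comp_id _).symm

@[simp] lemma incl_comp_coincl_self {Z A : C} (m : Z ⟶ A) (hm : MCategory.monics m) :
    incl m ≫ coincl m hm = 𝟙 _ := by
  have := MCategory.mono m hm
  rw [incl_comp_coincl hm (MCategory.iso_mem (𝟙 Z)) (IsKernelPair.id_of_mono m)]
  simp

lemma res_coincl_comp_incl {Z A B : C} (m : Z ⟶ A) (hm : MCategory.monics m) (f : Z ⟶ B) :
    res (coincl m hm ≫ incl f) = coincl m hm ≫ incl m := by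
  rw [coincl_comp_incl, coincl_comp_incl]
  rfl

lemma res_incl {A B : C} (f : A ⟶ B) : res (incl f) = 𝟙 _ := by
  simpa using res_coincl_comp_incl (𝟙 A) (MCategory.iso_mem _) f

lemma res_coincl {Z A : C} (m : Z ⟶ A) (hm : MCategory.monics m) :
    res (coincl m hm) = coincl m hm ≫ incl m := by
  simpa using res_coincl_comp_incl m hm (𝟙 Z)

/-- The spans `(m, m)` and `(1, 1)` represent the same map only through an isomorphism of their
apexes, and this isomorphism is `m`. -/
lemma isIso_of_coincl_comp_incl_eq_id {Z A : C} {m : Z ⟶ A} {hm : MCategory.monics m}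
    (h : coincl m hm ≫ incl m = 𝟙 _) : IsIso m := by
  have h' : coincl m hm ≫ incl m = coincl (𝟙 A) (MCategory.iso_mem _) ≫ incl (𝟙 A) := by
    simpa using h
  obtain ⟨φ, hφ, -⟩ := (coincl_comp_incl_eq_iff ..).1 h'
  rw [← hφ]
  infer_instance

/-- A map whose composite with a domain of definition is total factors through it. -/
lemma exists_fac_of_res_eq_id {E D X : C} {n : E ⟶ D} {hn : MCategory.monics n} {f : X ⟶ D}
    (h : res (incl f ≫ coincl n hn) = 𝟙 _) : ∃ g, g ≫ n = f := by
  obtain ⟨P, p, k, hP, hk⟩ := MCategory.exists_pullback n f hn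
  -- The composite has domain `k`, the pullback of `n` along `f`; totality makes `k` invertible.
  rw [incl_comp_coincl hn hk hP, res_coincl_comp_incl] at h
  have := isIso_of_coincl_comp_incl_eq_id h
  exact ⟨inv k ≫ p, by rw [Category.assoc, hP.w, IsIso.inv_hom_id_assoc]⟩

end Par

/-! ### Restrictions of elements and total maps -/

namespace RestrictionPresheaf

variable {X : Type u} [Category.{v} X] [RestrictionCategory X]

@[simp] lemma map_id_op (P : RestrictionPresheaf.{w} X) {A : X} (x : P.toFunctor.obj (op A)) :
    P.toFunctor.map (𝟙 A).op x = x := by simp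

/-- In the order of restriction idempotents, `comp_res` gives `res g ≤ res (x · g)` when `x` is
total, and `res_map_idempotent` applied to `res g` gives the converse. -/
lemma res_map_of_res_eq_id (P : RestrictionPresheaf.{w} X) {A B : X}
    {x : P.toFunctor.obj (op A)} (hx : P.res x = 𝟙 A) (g : B ⟶ A) :
    P.res (P.toFunctor.map g.op x) = RestrictionCategory.res g := by
  have h1 := P.comp_res x g
  rw [hx, Category.comp_id] at h1
  have h2 := P.res_map_idempotent (P.toFunctor.map g.op x) (RestrictionCategory.res g)
    (RestrictionCategory.res_res g)
  rw [map_map, RestrictionCategory.res_comp_self] at h2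
  have h3 := P.isRestrictionIdempotent_res (P.toFunctor.map g.op x)
  unfold RestrictionCategory.IsRestrictionIdempotent at h3
  rw [h2]
  conv_rhs => rw [h1, ← h3, RestrictionCategory.res_res_comp, h3]
  rw [← h3, RestrictionCategory.res_comm]

/-- A map is total if and only if it preserves restrictions of elements. -/
lemma total_iff {P Q : RestrictionPresheaf.{w} X} (α : P ⟶ Q) :
    RestrictionCategory.total _ α ↔
      ∀ (A : X) (x : P.toFunctor.obj (op A)), Q.res (α.nat.app (op A) x) = P.res x := by
  constructor
  · intro h A x
    have h1 : P.toFunctor.map (Q.res (α.nat.app (op A) x)).op x = x :=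
      congrArg (fun k : P ⟶ P => k.nat.app (op A) x) h
    -- `h2` becomes `res x ≤ res (α x)`, which uses totality; `h3` becomes the converse, which holds
    -- for every `α` by naturality.
    have h2 := P.res_map_idempotent x _ (Q.isRestrictionIdempotent_res (α.nat.app (op A) x))
    have h3 := Q.res_map_idempotent (α.nat.app (op A) x) _ (P.isRestrictionIdempotent_res x)
    rw [h1] at h2
    rw [← nat_map, map_res_self] at h3
    exact h3.trans ((res_comm P Q _ _).trans h2.symm)
  · intro h
    apply hom_ext
    intro A x
    change P.toFunctor.map (Q.res (α.nat.app (op A) x)).op x = x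
    rw [h, map_res_self]

end RestrictionPresheaf

/-! ### Distinguished maps of presheaves in terms of elements -/

namespace PShM

variable {C : Type u} [Category.{v} C]

lemma map_map (P : PShM.{w} C) {A B D : C} (x : P.obj (op A)) (f : B ⟶ A) (g : D ⟶ B) :
    P.map g.op (P.map f.op x) = P.map (g ≫ f).op x := by
  simp

variable [MCategory C]

/-- A distinguished map of presheaves, in terms of elements. -/
lemma monics_iff {P Q : PShM.{w} C} (μ : P ⟶ Q) :
    MCategory.monics μ ↔ ∀ (D : C) (y : Q.obj (op D)),
      ∃ (E : C) (n : E ⟶ D) (s : P.obj (op E)), MCategory.monics n ∧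
        μ.app _ s = Q.map n.op y ∧
        ∀ (X : C) (f : X ⟶ D) (z : P.obj (op X)), μ.app _ z = Q.map f.op y →
          ∃ g, g ≫ n = f ∧ z = P.map g.op s := by
  constructor
  · intro h D y
    obtain ⟨E, n, δ, hn, hp⟩ := h D (uliftYonedaEquiv.symm y)
    refine ⟨E, n, uliftYonedaEquiv δ, hn, ?_, fun X f z hz => ?_⟩
    · rw [← uliftYonedaEquiv_comp, hp.w]
      simp [uliftYonedaEquiv_comp]
    -- By Yoneda, a cone with representable vertex is a pair `(f, z)`, and its lift is a map `g` of
    -- `C`.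
    · have hw : uliftYonedaEquiv.{w}.symm z ≫ μ =
          uliftYoneda.{w}.map f ≫ uliftYonedaEquiv.{w}.symm y := by
        rw [uliftYonedaEquiv_symm_comp, hz, uliftYonedaEquiv_symm_map]
        rfl
      obtain ⟨g, hg⟩ := (uliftYoneda.{w} (C := C)).map_surjective (hp.lift _ _ hw)
      refine ⟨g, (uliftYoneda.{w} (C := C)).map_injective ?_, ?_⟩
      · rw [Functor.map_comp, hg, hp.lift_snd]
      · have := hp.lift_fst _ _ hw
        rw [← hg] at this
        rw [uliftYonedaEquiv_naturality]
        exact ((Equiv.symm_apply_eq _).1 this.symm)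
  · intro h D γ
    obtain ⟨y, rfl⟩ := uliftYonedaEquiv.symm.surjective γ
    obtain ⟨E, n, s, hn, hs, hl⟩ := h D y
    -- The condition on elements does not ask for uniqueness of `g`; it follows from `n` being
    -- monic.
    have := MCategory.mono n hn
    refine ⟨E, n, uliftYonedaEquiv.symm s, hn, IsPullback.of_forall_isPullback_app fun A => ?_⟩
    induction A using Opposite.rec with | _ A =>
    rw [Limits.Types.isPullback_iff]
    refine ⟨?_, ?_, ?_⟩
    · ext f
      change μ.app _ (P.map f.down.op s) = Q.map (f.down ≫ n).op y
      rw [NatTrans.naturality_apply, hs, map_map]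
    · rintro ⟨f⟩ ⟨g⟩ ⟨-, h⟩
      have h : f ≫ n = g ≫ n := congrArg ULift.down h
      rw [(cancel_mono n).1 h]
    · rintro z ⟨f⟩ hz
      obtain ⟨g, rfl, rfl⟩ := hl A f z hz
      exact ⟨⟨g⟩, rfl, rfl⟩

end PShM

/-! ### The functor of total elements -/

namespace RestrictionPresheaf

open RestrictionCategory

variable {C : Type u} [Category.{v} C] [MCategory C]

/-- Since `res x` is its own restriction, it is `(m, m)`, the composite of `(m, 1)` and `(1, m)`.
Then `x = x · res x` exhibits `t = x · (1, m)`, whose totality comes from cancelling `(1, m)` in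
`comp_res`. -/
lemma exists_eq_map_coincl (P : RestrictionPresheaf.{w} (Par C)) {A : C}
    (x : P.toFunctor.obj (op (Par.of A))) :
    ∃ (Z : C) (m : Z ⟶ A) (hm : MCategory.monics m) (t : P.toFunctor.obj (op (Par.of Z))),
      P.res t = 𝟙 _ ∧ x = P.toFunctor.map (Par.coincl m hm).op t := by
  obtain ⟨Z, m, hm, g, hg⟩ := Par.exists_eq_coincl_comp_incl (P.res x)
  have hx : P.res x = Par.coincl m hm ≫ Par.incl m := by
    rw [← Par.res_coincl_comp_incl m hm g, ← hg]
    exact (P.isRestrictionIdempotent_res x).symm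
  refine ⟨Z, m, hm, P.toFunctor.map (Par.incl m).op x, ?_, ?_⟩
  · have h := P.comp_res x (Par.incl m)
    rw [hx, ← Category.assoc, Par.incl_comp_coincl_self, Category.id_comp] at h
    have h2 := congrArg (· ≫ Par.coincl m hm) h
    simpa using h2.symm
  · rw [map_map, ← hx, map_res_self]

/-- The total elements of a restriction presheaf on `Par C`, as a presheaf on `C`. -/
@[simps] noncomputable def totalElements (P : RestrictionPresheaf.{max w v} (Par C)) : PShM.{w} C where
  obj A := { x : P.toFunctor.obj (op (Par.of A.unop)) // P.res x = 𝟙 _ }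
  map f := TypeCat.ofHom fun x => ⟨P.toFunctor.map (Par.incl f.unop).op x.1, by
    rw [res_map_of_res_eq_id P x.2, Par.res_incl]⟩
  map_id A := by
    ext x
    exact congrArg (fun k => k x.1) (P.toFunctor.map_id _)
  map_comp f g := by
    ext x
    change P.toFunctor.map (Par.incl (g.unop ≫ f.unop)).op x.1 = _
    rw [Par.incl_comp, ← map_map]
    rfl

/-- The action of a total map on total elements. -/
@[simps] noncomputable def totalElementsMap {P Q : RestrictionPresheaf.{max w v} (Par C)} (α : P ⟶ Q)
    (hα : total _ α) : totalElements.{w} P ⟶ totalElements.{w} Q where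
  app A := TypeCat.ofHom fun x => ⟨α.nat.app _ x.1, by rw [(total_iff α).1 hα, x.2]⟩
  naturality A B f := by
    ext x
    exact Subtype.ext (nat_map α x.1 (Par.incl f.unop))

variable (C) in
/-- The functor from the total maps of restriction presheaves on `Par C` to presheaves on `C`. -/
@[simps] noncomputable def totalElementsFunctor :
    Total (RestrictionPresheaf.{max w v} (Par C)) ⥤ PShM.{w} C where
  obj P := totalElements.{w} P.obj
  map α := totalElementsMap.{w} α.hom α.property

/-! ### Extension of transformations from total elements -/

section

variable {P Q : RestrictionPresheaf.{max w v} (Par C)}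
  (β : totalElements.{w} P ⟶ totalElements.{w} Q)

/-- The restrictions of the two sides are `(m, m)` and `(m', m')`, which yields `φ`; acting by `(1,
m)` then recovers `t`. -/
lemma map_incl_eq_of_map_coincl_eq {A Z Z' : C} {m : Z ⟶ A} {hm : MCategory.monics m}
    {m' : Z' ⟶ A} {hm' : MCategory.monics m'} {t : P.toFunctor.obj (op (Par.of Z))}
    {t' : P.toFunctor.obj (op (Par.of Z'))} (ht : P.res t = 𝟙 _) (ht' : P.res t' = 𝟙 _)
    (h : P.toFunctor.map (Par.coincl m hm).op t = P.toFunctor.map (Par.coincl m' hm').op t') :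
    ∃ φ : Z ≅ Z', φ.hom ≫ m' = m ∧ P.toFunctor.map (Par.incl φ.hom).op t' = t := by
  have hr := congrArg P.res h
  rw [res_map_of_res_eq_id P ht, res_map_of_res_eq_id P ht', Par.res_coincl, Par.res_coincl] at hr
  obtain ⟨φ, hφ, -⟩ := (Par.coincl_comp_incl_eq_iff ..).1 hr
  refine ⟨φ, hφ, ?_⟩
  have h2 := congrArg (fun x => P.toFunctor.map (Par.incl m).op x) h
  simp only [map_map, Par.incl_comp_coincl_self, map_id_op] at h2
  rw [h2, ← hφ, Par.incl_comp, Category.assoc, Par.incl_comp_coincl_self, Category.comp_id]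

lemma app_map_incl {A B : C} (t : P.toFunctor.obj (op (Par.of A))) (ht : P.res t = 𝟙 _)
    (f : B ⟶ A) (h) :
    (β.app (op B) ⟨P.toFunctor.map (Par.incl f).op t, h⟩).1 =
      Q.toFunctor.map (Par.incl f).op (β.app (op A) ⟨t, ht⟩).1 :=
  congrArg Subtype.val (NatTrans.naturality_apply β f.op ⟨t, ht⟩)

/-- A transformation on total elements extends to all elements. -/
lemma exists_extension (A : C) (x : P.toFunctor.obj (op (Par.of A))) :
    ∃ y : Q.toFunctor.obj (op (Par.of A)), ∀ (Z : C) (m : Z ⟶ A) (hm : MCategory.monics m)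
      (t : P.toFunctor.obj (op (Par.of Z))) (ht : P.res t = 𝟙 _),
      x = P.toFunctor.map (Par.coincl m hm).op t →
        y = Q.toFunctor.map (Par.coincl m hm).op (β.app (op Z) ⟨t, ht⟩).1 := by
  obtain ⟨Z, m, hm, t, ht, rfl⟩ := exists_eq_map_coincl P x
  refine ⟨Q.toFunctor.map (Par.coincl m hm).op (β.app (op Z) ⟨t, ht⟩).1,
    fun Z' m' hm' t' ht' h => ?_⟩
  -- Two decompositions differ by an isomorphism of domains, along which `β` is natural.
  obtain ⟨φ, rfl, rfl⟩ := map_incl_eq_of_map_coincl_eq ht ht' h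
  have := (Par.coincl_comp_incl_eq_iff (φ.hom ≫ m') hm φ.hom m' hm' (𝟙 _)).2 ⟨φ, by simp⟩
  rw [app_map_incl β t' ht', map_map, this, Par.incl_id, Category.comp_id]

/-- The extension of a transformation on total elements to all elements. -/
noncomputable def extend : P ⟶ Q where
  nat :=
    { app := fun A => TypeCat.ofHom fun x => (exists_extension β A.unop.base x).choose
      naturality := by
        rintro ⟨⟨A⟩⟩ ⟨⟨B⟩⟩ g
        obtain ⟨g, rfl⟩ : ∃ k : Par.of B ⟶ Par.of A, g = k.op := ⟨g.unop, rfl⟩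
        ext x
        change (exists_extension β B (P.toFunctor.map g.op x)).choose =
          Q.toFunctor.map g.op (exists_extension β A x).choose
        obtain ⟨Z, m, hm, t, ht, rfl⟩ := exists_eq_map_coincl P x
        -- Writing `g` followed by `(m, 1)` as a span `(k, f)` decomposes `(t · (m, 1)) · g` as `(t
        -- · f) · (k, 1)` with `t · f` total; the chosen value satisfies its equation for every
        -- decomposition, hence for this one.
        obtain ⟨W, k, hk, f, hg⟩ := Par.exists_eq_coincl_comp_incl (g ≫ Par.coincl m hm)
        have h := res_map_of_res_eq_id P ht (Par.incl f)
        rw [Par.res_incl] at h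
        rw [(exists_extension β A _).choose_spec Z m hm t ht rfl,
          (exists_extension β B _).choose_spec W k hk (P.toFunctor.map (Par.incl f).op t) h ?_,
          app_map_incl β t ht, map_map, map_map, hg]
        rw [map_map, map_map, hg] }

lemma extend_apply {A Z : C} (m : Z ⟶ A) (hm : MCategory.monics m)
    (t : P.toFunctor.obj (op (Par.of Z))) (ht : P.res t = 𝟙 _) :
    (extend β).nat.app (op (Par.of A)) (P.toFunctor.map (Par.coincl m hm).op t) =
      Q.toFunctor.map (Par.coincl m hm).op (β.app (op Z) ⟨t, ht⟩).1 :=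
  (exists_extension β A _).choose_spec Z m hm t ht rfl

lemma total_extend : total _ (extend β) := by
  rw [total_iff]
  rintro ⟨A⟩ x
  obtain ⟨Z, m, hm, t, ht, rfl⟩ := exists_eq_map_coincl P x
  rw [extend_apply β m hm t ht, res_map_of_res_eq_id P ht, 
    res_map_of_res_eq_id Q (β.app (op Z) ⟨t, ht⟩).2]

end

instance : (totalElementsFunctor.{w} C).Full where
  map_surjective {P Q} β := by
    refine ⟨⟨extend β, total_extend β⟩, ?_⟩
    ext ⟨A⟩ x
    apply Subtype.ext
    have := extend_apply β (𝟙 A) (MCategory.iso_mem _) x.1 x.2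
    rw [Par.coincl_id, map_id_op, map_id_op] at this
    exact this

instance : (totalElementsFunctor.{w} C).Faithful where
  map_injective {P Q} α β h := by
    apply WideSubcategory.hom_ext
    apply hom_ext
    rintro ⟨A⟩ x
    obtain ⟨Z, m, hm, t, ht, rfl⟩ := exists_eq_map_coincl P.obj x
    rw [nat_map, nat_map]
    congr 1
    exact congrArg Subtype.val (congrArg (fun k => k.app (op Z) ⟨t, ht⟩) h)

/-! ### Restriction monics and distinguished maps -/

section

variable {P Q : RestrictionPresheaf.{max w v} (Par C)} {μ : P ⟶ Q} (hμ : total _ μ)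
include hμ

/-- For total `y`, write `r y = t · (n, 1)`. Then `n` and `t` give the required pullback: `μ (r y)`
is the restriction of `y` to `n`, and if `μ z = y · f` then `z = r (μ z) = (r y) · f`, so totality
of `z` forces `f` to factor through `n`. -/
lemma monics_totalElementsMap (h : IsRestrictionMonic μ) :
    MCategory.monics (totalElementsMap.{w} μ hμ) := by
  rw [total_iff] at hμ
  obtain ⟨r, hr, hmr⟩ := h
  have hr1 {A : Par C} (y : Q.toFunctor.obj (op A)) : μ.nat.app (op A) (r.nat.app (op A) y) =
      Q.toFunctor.map (Q.res (μ.nat.app (op A) (r.nat.app (op A) y))).op y :=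
    congrArg (fun k : Q ⟶ Q => k.nat.app (op A) y) (Eq.symm hr)
  have hr2 {A : Par C} (z : P.toFunctor.obj (op A)) :
      r.nat.app (op A) (μ.nat.app (op A) z) = z :=
    congrArg (fun k : P ⟶ P => k.nat.app (op A) z) hmr
  rw [PShM.monics_iff]
  rintro D ⟨y, hy⟩
  obtain ⟨E, n, hn, t, ht, hx⟩ := exists_eq_map_coincl P (r.nat.app (op (Par.of D)) y)
  have hres : P.res (r.nat.app (op (Par.of D)) y) = Par.coincl n hn ≫ Par.incl n := by
    rw [hx, res_map_of_res_eq_id P ht, Par.res_coincl]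
  have hyn : μ.nat.app _ t = Q.toFunctor.map (Par.incl n).op y := by
    have h1 := hr1 y
    rw [hμ, hres, ← map_map, hx, nat_map] at h1
    have h2 := congrArg (fun x => Q.toFunctor.map (Par.incl n).op x) h1
    simpa only [map_map, Par.incl_comp_coincl_self, map_id_op, ← Category.assoc,
      Category.id_comp] using h2
  refine ⟨E, n, ⟨t, ht⟩, hn, Subtype.ext hyn, ?_⟩
  rintro X f ⟨z, hz⟩ h
  have h : μ.nat.app _ z = Q.toFunctor.map (Par.incl f).op y := congrArg Subtype.val h
  have hz' : z = P.toFunctor.map (Par.incl f ≫ Par.coincl n hn).op t := by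
    rw [← hr2 z, h, nat_map, hx, map_map]
  have hf : RestrictionCategory.res (Par.incl f ≫ Par.coincl n hn) = 𝟙 _ := by
    rw [← res_map_of_res_eq_id P ht, ← hz', hz]
  obtain ⟨g, rfl⟩ := Par.exists_fac_of_res_eq_id hf
  rw [Par.incl_comp, Category.assoc, Par.incl_comp_coincl_self, Category.comp_id] at hz'
  exact ⟨g, rfl, Subtype.ext hz'⟩

/-- The largest part of `y` in the image of a map, as the image of a unique `x`. -/
lemma exists_maximal_preimage (h : MCategory.monics (totalElementsMap.{w} μ hμ)) {A : Par C}
    (y : Q.toFunctor.obj (op A)) :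
    ∃ x : P.toFunctor.obj (op A), μ.nat.app _ x = Q.toFunctor.map (P.res x).op y ∧
      ∀ (B : Par C) (f : B ⟶ A) (z : P.toFunctor.obj (op B)),
        μ.nat.app _ z = Q.toFunctor.map f.op y → z = P.toFunctor.map f.op x := by
  rw [PShM.monics_iff] at h
  obtain ⟨A⟩ := A
  obtain ⟨Z, m, hm, t, ht, rfl⟩ := exists_eq_map_coincl Q y
  obtain ⟨E, n, ⟨s, hs⟩, hn, hst, hl⟩ := h Z ⟨t, ht⟩
  have hst : μ.nat.app _ s = Q.toFunctor.map (Par.incl n).op t := congrArg Subtype.val hst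
  -- With `y = t · (m, 1)`, the part of `t` lying in the image is `μ s` on `n`; it is extended along
  -- both monics.
  refine ⟨P.toFunctor.map (Par.coincl (n ≫ m) (MCategory.comp_mem _ _ hn hm)).op s, ?_, ?_⟩
  · rw [nat_map, hst, res_map_of_res_eq_id P hs, Par.res_coincl, map_map, map_map, Par.incl_comp]
    simp
  · rintro ⟨B⟩ f z hz
    obtain ⟨W, k, hk, z, hzt, rfl⟩ := exists_eq_map_coincl P z
    -- As `μ` preserves restrictions, comparing those of both sides identifies the domain of `z`
    -- with that of `f` followed by `(m, 1)`. This reduces the claim to the total part of `z`, where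
    -- the universal property of `s` applies.
    have hres := congrArg Q.res hz
    rw [map_map] at hz hres
    obtain ⟨W', k', hk', g, hg⟩ := Par.exists_eq_coincl_comp_incl (f ≫ Par.coincl m hm)
    rw [(total_iff μ).1 hμ, res_map_of_res_eq_id P hzt, res_map_of_res_eq_id Q ht, hg,
      Par.res_coincl, Par.res_coincl_comp_incl, Par.coincl_comp_incl_eq_iff] at hres
    obtain ⟨φ, rfl, -⟩ := hres
    rw [nat_map, hg, (Par.coincl_comp_incl_eq_iff k' hk' g _ hk (φ.hom ≫ g)).2
      ⟨φ.symm, by simp⟩, ← map_map] at hz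
    have hz := congrArg (fun x => Q.toFunctor.map (Par.incl (φ.hom ≫ k')).op x) hz
    simp only [map_map, Par.incl_comp_coincl_self, map_id_op, ← Category.assoc,
      Category.id_comp] at hz
    obtain ⟨h, hh, hzh⟩ := hl W (φ.hom ≫ g) ⟨z, hzt⟩ (Subtype.ext hz)
    have hzh : z = P.toFunctor.map (Par.incl h).op s := congrArg Subtype.val hzh
    rw [hzh, map_map, map_map, Par.coincl_comp n hn m hm, ← Category.assoc f, hg,
      (Par.coincl_comp_incl_eq_iff k' hk' g _ hk (φ.hom ≫ g)).2 ⟨φ.symm, by simp⟩, ← hh,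
      Par.incl_comp, Category.assoc, Category.assoc, Par.incl_comp_coincl_self,
      Category.comp_id]

/-- The retraction sends `y` to its maximal preimage. Maximality makes this choice unique, hence
natural, and gives `r (μ x) = x`. -/
lemma isRestrictionMonic_of_monics (h : MCategory.monics (totalElementsMap.{w} μ hμ)) :
    IsRestrictionMonic μ := by
  choose r hr1 hr2 using fun A : Par C => exists_maximal_preimage hμ h (A := A)
  -- If each of `x`, `x'` is a restriction of the other, their restriction idempotents bound each
  -- other and so agree.
  have huniq {A : Par C} {x x' : P.toFunctor.obj (op A)} {y : Q.toFunctor.obj (op A)}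
      (h1 : μ.nat.app _ x = Q.toFunctor.map (P.res x).op y)
      (h1' : μ.nat.app _ x' = Q.toFunctor.map (P.res x').op y)
      (h2 : x = P.toFunctor.map (P.res x).op x')
      (h2' : x' = P.toFunctor.map (P.res x').op x) : x = x' := by
    have e := P.res_map_idempotent x' _ (P.isRestrictionIdempotent_res x)
    have e' := P.res_map_idempotent x _ (P.isRestrictionIdempotent_res x')
    rw [← h2] at e
    rw [← h2', res_comm, ← e] at e'
    rw [h2, ← e', map_res_self]
  refine ⟨⟨{ app := fun A => TypeCat.ofHom (r A.unop), naturality := ?_ }⟩, ?_, ?_⟩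
  · rintro ⟨A⟩ ⟨B⟩ g
    obtain ⟨g, rfl⟩ : ∃ k : B ⟶ A, g = k.op := ⟨g.unop, rfl⟩
    ext y
    change r B (Q.toFunctor.map g.op y) = P.toFunctor.map g.op (r A y)
    have h1 : μ.nat.app _ (P.toFunctor.map g.op (r A y)) =
        Q.toFunctor.map (P.res (P.toFunctor.map g.op (r A y))).op (Q.toFunctor.map g.op y) := by
      rw [nat_map, hr1, map_map, map_map, P.comp_res]
    refine huniq (hr1 B _) h1 ?_ (hr2 _ _ _ _ _ h1)
    rw [map_map]
    apply hr2
    rw [hr1, map_map]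
  · apply hom_ext
    intro A y
    change Q.toFunctor.map (Q.res (μ.nat.app (op A) (r A y))).op y = μ.nat.app (op A) (r A y)
    rw [(total_iff μ).1 hμ, ← hr1]
  · apply hom_ext
    intro A x
    change r A (μ.nat.app (op A) x) = x
    have := hr2 A (μ.nat.app _ x) A (𝟙 A) x (by simp)
    simpa using this.symm

end

end RestrictionPresheaf

/-! ### Partial elements of a presheaf -/

section

variable {C : Type u} [Category.{v} C] [MCategory C]

/-- A partial element of `Q` at `A`: an element of `Q` at the domain of a distinguished monic
into `A`. -/
structure PartialElement (Q : PShM.{w} C) (A : C) where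
  dom : C
  mon : dom ⟶ A
  mem : MCategory.monics mon
  val : Q.obj (op dom)

namespace PartialElement

variable {Q : PShM.{w} C}

/-- Two partial elements are identified if they are isomorphic. -/
instance setoid (Q : PShM.{w} C) (A : C) : Setoid (PartialElement Q A) where
  r a b := ∃ φ : a.dom ≅ b.dom, φ.hom ≫ b.mon = a.mon ∧ Q.map φ.hom.op b.val = a.val
  iseqv :=
    { refl := fun a => ⟨Iso.refl _, by simp, by simp⟩
      symm := by
        rintro a b ⟨φ, h1, h2⟩
        exact ⟨φ.symm, by simp [← h1], by rw [← h2, PShM.map_map]; simp⟩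
      trans := by
        rintro a b c ⟨φ, h1, h2⟩ ⟨ψ, h3, h4⟩
        exact ⟨φ ≪≫ ψ, by simp [h3, h1], by rw [← h2, ← h4, PShM.map_map]; rfl⟩ }

lemma mk_equiv_mk {A P : C} {m m' : P ⟶ A} (hm : MCategory.monics m) (hm' : MCategory.monics m')
    {x x' : Q.obj (op P)} (h : m = m') (h' : x = x') :
    (⟨P, m, hm, x⟩ : PartialElement Q A) ≈ ⟨P, m', hm', x'⟩ :=
  ⟨Iso.refl _, by simp [h], by simp [h']⟩

/-- The action of a span on a partial element, given a completion of the cospan in the middle. -/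
def glue {A B : C} (a : PartialMap A B) (b : PartialElement Q B) {P : C} (g : P ⟶ b.dom)
    (n : P ⟶ a.dom) (hn : MCategory.monics n) : PartialElement Q A where
  dom := P
  mon := n ≫ a.mon
  mem := MCategory.comp_mem _ _ hn a.mem
  val := Q.map g.op b.val

lemma glue_equiv {A B : C} {a a' : PartialMap A B} {b b' : PartialElement Q B} (ha : a ≈ a')
    (hb : b ≈ b') {P P' : C} {g : P ⟶ b.dom} {n : P ⟶ a.dom} (hn : MCategory.monics n)
    (h : IsPullback g n b.mon a.map) {g' : P' ⟶ b'.dom} {n' : P' ⟶ a'.dom}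
    (hn' : MCategory.monics n') (h' : IsPullback g' n' b'.mon a'.map) :
    glue a b g n hn ≈ glue a' b' g' n' hn' := by
  obtain ⟨φ, h1, h2⟩ := ha
  obtain ⟨ψ, h3, h4⟩ := hb
  have h'' : IsPullback (g ≫ ψ.hom) (n ≫ φ.hom) b'.mon a'.map :=
    IsPullback.of_iso h (Iso.refl _) ψ φ (Iso.refl _) (by simp) (by simp) (by simp [h3])
      (by simp [h2])
  refine ⟨h''.isoIsPullback _ _ h', ?_, ?_⟩
  · have := h''.isoIsPullback_hom_snd _ _ h'
    exact (Category.assoc _ _ _).symm.trans ((congrArg (· ≫ a'.mon) this).trans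
      ((Category.assoc _ _ _).trans (congrArg (n ≫ ·) h1)))
  · have := h''.isoIsPullback_hom_fst _ _ h'
    exact (PShM.map_map Q _ _ _).trans ((congrArg (fun k => Q.map k.op b'.val) this).trans
      ((PShM.map_map Q _ _ _).symm.trans (congrArg (Q.map g.op) h4)))

/-- The action of a span on a partial element, by pullback. -/
noncomputable def act {A B : C} (a : PartialMap A B) (b : PartialElement Q B) :
    PartialElement Q A :=
  have h := MCategory.exists_pullback b.mon a.map b.mem
  glue a b h.choose_spec.choose h.choose_spec.choose_spec.choose
    h.choose_spec.choose_spec.choose_spec.2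

lemma act_equiv_glue {A B : C} {a a' : PartialMap A B} {b b' : PartialElement Q B} (ha : a ≈ a')
    (hb : b ≈ b') {P : C} {g : P ⟶ b'.dom} {n : P ⟶ a'.dom} (hn : MCategory.monics n)
    (h : IsPullback g n b'.mon a'.map) : act a b ≈ glue a' b' g n hn :=
  have h' := (MCategory.exists_pullback b.mon a.map b.mem).choose_spec.choose_spec.choose_spec
  glue_equiv ha hb h'.2 h'.1 hn h

lemma act_congr {A B : C} {a a' : PartialMap A B} {b b' : PartialElement Q B} (ha : a ≈ a')
    (hb : b ≈ b') : act a b ≈ act a' b' :=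
  have h := (MCategory.exists_pullback b'.mon a'.map b'.mem).choose_spec.choose_spec.choose_spec
  act_equiv_glue ha hb h.2 h.1

variable (Q) in
/-- Isomorphism classes of partial elements. -/
abbrev Class (A : C) := Quotient (PartialElement.setoid Q A)

/-- The isomorphism class of a partial element. -/
def toClass {A : C} (b : PartialElement Q A) : Class Q A := Quotient.mk _ b

lemma toClass_eq_iff {A : C} (a b : PartialElement Q A) :
    toClass a = toClass b ↔ a ≈ b := Quotient.eq

/-- The action of a partial map on classes of partial elements. -/
noncomputable def classAct {A B : Par C} (f : A ⟶ B) (x : Class Q B.base) : Class Q A.base :=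
  Quotient.map₂ PartialElement.act (fun _ _ ha _ _ hb => act_congr ha hb) f x

lemma classAct_toClass {A B : Par C} (a : PartialMap A.base B.base) (b : PartialElement Q B.base)
    {P : C} {g : P ⟶ b.dom} {n : P ⟶ a.dom} (hn : MCategory.monics n)
    (h : IsPullback g n b.mon a.map) :
    classAct (Par.homMk a : A ⟶ B) (toClass b) = toClass (glue a b g n hn) :=
  Quotient.sound (act_equiv_glue (Setoid.refl a) (Setoid.refl b) hn h)

lemma classAct_id {A : Par C} (x : Class Q A.base) : classAct (𝟙 A) x = x := by
  induction x using Quotient.inductionOn with | _ b =>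
  refine (classAct_toClass (A := A) (B := A) (PartialMap.id A.base) b (g := 𝟙 b.dom)
    (n := b.mon) b.mem (IsPullback.id_horiz b.mon)).trans ?_
  exact Quotient.sound (mk_equiv_mk _ _ (Category.comp_id _) (by simp))

lemma classAct_comp {A B D : Par C} (f : A ⟶ B) (g : B ⟶ D) (x : Class Q D.base) :
    classAct (f ≫ g) x = classAct f (classAct g x) := by
  obtain ⟨a, rfl⟩ := Par.homMk_surjective f
  obtain ⟨b, rfl⟩ := Par.homMk_surjective g
  induction x using Quotient.inductionOn with | _ c =>
  obtain ⟨P, p, n, hP, hn⟩ := MCategory.exists_pullback b.mon a.map b.mem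
  obtain ⟨R, q, k, hQ, hk⟩ := MCategory.exists_pullback c.mon b.map c.mem
  obtain ⟨S, s, l, hR, hl⟩ := MCategory.exists_pullback k p hk
  change classAct _ (toClass c) = classAct _ (classAct _ (toClass c))
  rw [Par.homMk_comp (A := A) (B := B) (D := D) a b hn hP,
    classAct_toClass (A := B) (B := D) b c hk hQ,
    classAct_toClass (A := A) (B := D) (PartialMap.glue a b p n hn) c hl (hR.paste_horiz hQ),
    classAct_toClass (A := A) (B := B) a (glue b c q k hk) (n := l ≫ n) (g := s)
      (MCategory.comp_mem _ _ hl hn) (hR.paste_vert hP), toClass_eq_iff]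
  exact mk_equiv_mk _ _ (Category.assoc _ _ _).symm (PShM.map_map _ _ _ _).symm

/-- The restriction of a class of partial elements, a partial identity. -/
def classRes {A : Par C} (x : Class Q A.base) : A ⟶ A :=
  Quotient.map (sb := PartialMap.setoid A.base A.base)
    (fun b : PartialElement Q A.base => (⟨b.dom, b.mon, b.mem, b.mon⟩ : PartialMap A.base A.base))
    (by rintro a b ⟨φ, h1, h2⟩; exact ⟨φ, h1, h1⟩) x

lemma classRes_toClass {A : Par C} (b : PartialElement Q A.base) :
    classRes (toClass b) = (Par.homMk ⟨b.dom, b.mon, b.mem, b.mon⟩ : A ⟶ A) := rfl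

end PartialElement

open PartialElement in
/-- The restriction presheaf of partial elements of a presheaf. -/
noncomputable def PShM.partialElements (Q : PShM.{max w u} C) :
    RestrictionPresheaf.{max w u v} (Par C) where
  toFunctor :=
    { obj := fun A => Class Q A.unop.base
      map := fun f => TypeCat.ofHom fun x => classAct f.unop x
      map_id := fun A => by
        ext x
        exact classAct_id x
      map_comp := fun f g => by
        ext x
        exact classAct_comp g.unop f.unop x }
  res x := classRes x
  isRestrictionIdempotent_res x := by
    induction x using Quotient.inductionOn with | _ b => rfl
  map_res_self {A} x := by
    induction x using Quotient.inductionOn with | _ b =>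
    have := MCategory.mono _ b.mem
    refine (classAct_toClass (A := A) (B := A) ⟨b.dom, b.mon, b.mem, b.mon⟩ b (g := 𝟙 b.dom)
      (n := 𝟙 b.dom) (MCategory.iso_mem _) (IsKernelPair.id_of_mono b.mon)).trans ?_
    exact Quotient.sound (mk_equiv_mk _ _ (Category.id_comp _) (by simp))
  res_map_idempotent {A} x e he := by
    obtain ⟨a, rfl⟩ := Par.homMk_surjective e
    change Par.restr _ = _ at he
    rw [← he, Par.restr_homMk]
    induction x using Quotient.inductionOn with | _ b =>
    obtain ⟨P, p, n, hP, hn⟩ := MCategory.exists_pullback b.mon a.mon b.mem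
    change classRes (A := A) (classAct (A := A) (B := A) (Par.homMk a.restr) (toClass b)) =
      Par.homMk a.restr ≫ classRes (A := A) (toClass b)
    rw [classAct_toClass (A := A) (B := A) a.restr b hn hP, classRes_toClass, classRes_toClass,
      Par.homMk_comp (A := A) (B := A) (D := A) a.restr _ hn hP, Par.homMk_eq_iff]
    exact PartialMap.mk_equiv_mk _ _ rfl hP.w.symm
  comp_res {A B} x g := by
    obtain ⟨a, rfl⟩ := Par.homMk_surjective g
    induction x using Quotient.inductionOn with | _ b =>
    obtain ⟨P, p, n, hP, hn⟩ := MCategory.exists_pullback b.mon a.map b.mem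
    have hm := MCategory.mono _ a.mem
    change Par.homMk a ≫ classRes (A := A) (toClass b) =
      classRes (A := B) (classAct (A := B) (B := A) (Par.homMk a) (toClass b)) ≫ Par.homMk a
    rw [classAct_toClass (A := B) (B := A) a b hn hP, classRes_toClass, classRes_toClass,
      Par.homMk_comp (A := B) (B := A) (D := A) a _ hn hP,
      Par.homMk_comp (A := B) (B := B) (D := A) _ a (g := n) (n := 𝟙 P) (MCategory.iso_mem (𝟙 P))
        ?_, Par.homMk_eq_iff]
    · exact PartialMap.mk_equiv_mk _ _ (Category.id_comp _).symm hP.w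
    -- `n ≫ a.mon` already factors through the monic `a.mon`, so the pullback is all of `P`.
    · change IsPullback n (𝟙 P) a.mon (n ≫ a.mon)
      refine ⟨⟨by simp⟩, ⟨Limits.PullbackCone.IsLimit.mk _ (fun c => c.snd) (fun c => ?_)
        (fun c => by simp) (fun c k _ hk => by simpa using hk)⟩⟩
      rw [← cancel_mono a.mon]
      simpa using c.condition.symm

/-! ### A presheaf as the total part of its partial elements -/

namespace PShM

open PartialElement RestrictionPresheaf

variable (Q : PShM.{max w u} C)

/-- The total partial element given by an element of a presheaf. -/
noncomputable def toTotalElements :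
    Q ⟶ totalElements.{max w u} (partialElements.{w} Q) where
  app A := TypeCat.ofHom fun x => ⟨toClass ⟨A.unop, 𝟙 _, MCategory.iso_mem _, x⟩, rfl⟩
  naturality A B f := by
    ext x
    apply Subtype.ext
    refine Eq.symm ((classAct_toClass (A := Par.of B.unop) (B := Par.of A.unop)
      ⟨B.unop, 𝟙 _, MCategory.iso_mem _, f.unop⟩ ⟨A.unop, 𝟙 _, MCategory.iso_mem _, x⟩
      (g := f.unop) (n := 𝟙 _) (MCategory.iso_mem _) (IsPullback.id_vert f.unop)).trans ?_)
    exact Quotient.sound (mk_equiv_mk _ _ (Category.id_comp _) rfl)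

/-- The class of `(m, q)` has restriction `(m, m)`, so it is total only if `m` is invertible, and
then it is the class of `(1, q · m⁻¹)`. An isomorphism between pairs with first entry `1` is the
identity, which gives injectivity. -/
instance : IsIso (toTotalElements.{w} Q) := by
  rw [NatTrans.isIso_iff_isIso_app]
  rintro ⟨A⟩
  rw [isIso_iff_bijective]
  constructor
  · intro x y h
    obtain ⟨φ, h1, h2⟩ := (toClass_eq_iff _ _).1 (congrArg Subtype.val h)
    have h1 : φ.hom ≫ 𝟙 A = 𝟙 A := h1
    rw [Category.comp_id] at h1
    have h2 : Q.map φ.hom.op y = x := h2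
    rw [← h2, h1]
    simp
  · rintro ⟨x, hx⟩
    induction x using Quotient.inductionOn with | _ b =>
    have hx : (Par.homMk ⟨b.dom, b.mon, b.mem, b.mon⟩ : Par.of A ⟶ Par.of A) = 𝟙 _ := hx
    rw [← Par.coincl_comp_incl b.mon b.mem b.mon] at hx
    have := Par.isIso_of_coincl_comp_incl_eq_id hx
    refine ⟨Q.map (inv b.mon).op b.val, Subtype.ext (Quotient.sound ?_)⟩
    exact ⟨(asIso b.mon).symm, by simp, rfl⟩

end PShM

/-- The universe `max w u` enters here: a partial element carries its domain, an object of `C`, so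
the sets of values must be large enough to contain the objects of `C`. -/
instance : (RestrictionPresheaf.totalElementsFunctor.{max w u} C).EssSurj where
  mem_essImage Q := ⟨⟨PShM.partialElements.{w} Q⟩, ⟨(asIso (PShM.toTotalElements.{w} Q)).symm⟩⟩

end

/-! ### Equivalences of M-categories -/

section

variable {C : Type u₁} [Category.{v₁} C] [MCategory C] {D : Type u₂} [Category.{v₂} D]

/-- A commutative square with two opposite sides invertible is a pullback. -/
lemma IsMCartesian.of_isIso {F G : C ⥤ D} (α : F ⟶ G) [IsIso α] : IsMCartesian α :=
  fun _ _ m _ => IsPullback.of_horiz_isIso ⟨(α.naturality m).symm⟩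

instance MCategory.respectsIso_monics : (MCategory.monics (C := C)).RespectsIso :=
  MorphismProperty.RespectsIso.mk _
    (fun _ _ hf => MCategory.comp_mem _ _ (MCategory.iso_mem _) hf)
    (fun _ _ hf => MCategory.comp_mem _ _ hf (MCategory.iso_mem _))

variable [MCategory D]

/-- An equivalence that preserves and reflects the distinguished monics is an equivalence of
M-categories. -/
def MEquivalence.ofEquivalence (e : C ≌ D)
    (he : ∀ {A B : C} (m : A ⟶ B), MCategory.monics (e.functor.map m) ↔ MCategory.monics m) :
    MEquivalence C D where
  functor := e.functor
  inverse := e.inverse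
  unitIso := e.unitIso
  counitIso := e.counitIso
  isMFunctor_functor := ⟨fun m hm => (he m).2 hm, fun _ _ _ _ _ h => h.map _⟩
  isMFunctor_inverse := by
    refine ⟨fun m hm => (he _).1 ?_, fun _ _ _ _ _ h => h.map _⟩
    -- The counit makes the image of `m` under the round trip isomorphic to `m` as an arrow, and
    -- distinguished monics are closed under such isomorphisms.
    exact ((MCategory.monics (C := D)).arrow_mk_iso_iff
      (Arrow.isoOfNatIso e.counitIso (Arrow.mk m))).2 hm
  isMCartesian_unitIso_hom := .of_isIso _
  isMCartesian_unitIso_inv := .of_isIso _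
  isMCartesian_counitIso_hom := .of_isIso _
  isMCartesian_counitIso_inv := .of_isIso _

end

theorem mainTheorem5 (C : Type u) [Category.{v} C] [MCategory C] :
    Nonempty (MEquivalence (RestrictionCategory.Total (RestrictionPresheaf.{max w u v} (Par C)))
      (PShM.{max w u} C)) := by
  let F := RestrictionPresheaf.totalElementsFunctor.{max w u} C
  have : F.IsEquivalence := {}
  exact ⟨.ofEquivalence F.asEquivalence fun m =>
    ⟨RestrictionPresheaf.isRestrictionMonic_of_monics m.property,
      RestrictionPresheaf.monics_totalElementsMap m.property⟩⟩
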